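/- For $a,b\in\mathbb{R}$ let the polynomials $P_n(z)=P_n^{(a,b)}(z)\in\mathbb{R}[z]$, $n\ge 0$, be generated by the formal power series identity \[ \sum_{n=0}^{\infty}P_n(z)t^n=\frac{1}{(t+1)\big((az+b)t^2+zt+1\big)} . \] (1) All complex zeros of all the polynomials $P_n(z)$, $n\ge 0$, are real if and only if $b\ge 1+2|a|$. (2) If $b\ge 1+2|a|$, then for every $n$ all complex zeros of $P_n(z)$ lie in the open interval \[ I=\left(2a-2\sqrt{a^2+b},\;2a+2\sqrt{a^2+b}\right)\subset\mathbb{R}, \] and the zeros of $P_n(z)$ become dense in $I$ as $n\to\infty$: for every $x\in I$ and every $\varepsilon>0$ there is $N$ such that for every $n\ge N$ the polynomial $P_n$ has a real zero $y$ with $|y-x|<\varepsilon$. (3) Let $a_1,b_1,a_2,b_2\in\mathbb{R}$ with $a_1\neq 0$, and let $R_n(z)$ be defined by $R_{n+1}(z)=(a_1z+b_1)R_n(z)+(a_2z+b_2)R_{n-1}(z)$ for $n\ge 0$, with $R_0(z)=1$ and $R_{-1}(z)=0$. Then for every $n\ge 0$ \[ \sum_{k=0}^{n}R_k(z)=(-1)^n\,P_n^{(a,b)}(a_1z+b_1),\qquad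 a=-\frac{a_2}{a_1},\quad b=\frac{a_2b_1}{a_1}-b_2 . \] -/

import Mathlib

open Polynomial Filter

noncomputable section

/-- The denominator `(t + 1) ((a z + b) t² + z t + 1)`, as a formal power series in `t` whose
coefficients are real polynomials in the variable `z`. -/
def genDenom (a b : ℝ) : PowerSeries ℝ[X] :=
  (PowerSeries.X + 1) *
    (PowerSeries.C (C a * X + C b) * PowerSeries.X ^ 2 + PowerSeries.C X * PowerSeries.X + 1)

/-- The polynomial `P_n(z)`: the coefficient of `t ^ n` in the formal power series
`1 / ((t + 1) ((a z + b) t² + z t + 1))`. -/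
def genPoly (a b : ℝ) (n : ℕ) : ℝ[X] :=
  PowerSeries.coeff n (PowerSeries.invOfUnit (genDenom a b) 1)

/-- The defining property: `(∑ P_n(z) t ^ n) * ((t + 1) ((a z + b) t² + z t + 1)) = 1`. -/
theorem mk_genPoly_mul_genDenom (a b : ℝ) :
    PowerSeries.mk (genPoly a b) * genDenom a b = 1 := by
  have h : PowerSeries.mk (genPoly a b) = PowerSeries.invOfUnit (genDenom a b) 1 := by
    ext1 n
    simp [genPoly]
  rw [h]
  exact PowerSeries.invOfUnit_mul _ _ (by simp [genDenom])

/-- The polynomials `R_n(z)` with `R_{n+1} = (a₁ z + b₁) R_n + (a₂ z + b₂) R_{n-1}`, `R_0 = 1`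
and `R_{-1} = 0`. -/
def recPoly (a₁ b₁ a₂ b₂ : ℝ) : ℕ → ℝ[X]
  | 0 => 1
  | 1 => C a₁ * X + C b₁
  | n + 2 => (C a₁ * X + C b₁) * recPoly a₁ b₁ a₂ b₂ (n + 1) +
      (C a₂ * X + C b₂) * recPoly a₁ b₁ a₂ b₂ n

end

/-! The proof runs through the partial sums `Q_n = R_0 + ⋯ + R_n = (-1) ^ n P_n` of the monic
solution of `R_{k+1} = z R_k - (a z + b) R_{k-1}` (`genPoly_eq`), a monic polynomial of degree `n`.
The general recurrence with `a₁ ≠ 0` reduces to this one by substituting `a₁ z + b₁` for `z`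
(`sum_recPoly`). Let `u`, `v` be the characteristic roots, with `u + v = z` and `u v = a z + b`;
when `0 < a² + b`, the real `z` for which they are not real are exactly those of `I`.

If `1 + 2 |a| ≤ b`, then `I` is the curve `z = 2 ρ cos θ` with `u, v = ρ e^{±iθ}` and, crucially,
`ρ ≥ 1`. The resulting closed form of `Q_n` alternates in sign at the `n + 1` angles
`2 j π / (2 n + 3)`, `1 ≤ j ≤ n + 1` (`neg_one_pow_mul_eval_nodeAngle_neg`). The intermediate value
theorem gives `n` distinct zeros in `I`, hence all of them (`zeros_mem_Ioo`); as consecutive angles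
differ by `2 π / (2 n + 3)`, the zeros become dense (`eventually_exists_zero_near`).

If `b < 1 + 2 |a|`, the growth of `Q_n` contradicts real-rootedness (`exists_nonreal_zero_of_lt`).
For `a² + b ≤ 0` already `Q_2` has negative discriminant. For `b < -1` the `Q_{2m}` have no zeros on
some `[-h, h]`, so that real-rootedness would give `Q_{2m}(h) Q_{2m}(-h) ≤ Q_{2m}(0)²`; but the
dominant characteristic roots make the left side exponentially larger. Otherwise, at one end point
`x` of `I` the double characteristic root is inside the unit disc. Then `Q_n(x)` has a nonzero limit
and `Q_n(x + iy)` is bounded for small `y > 0`, whereas for real zeros, all in one bounded set,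
`|Q_n(x + iy) / Q_n(x)|` would grow exponentially. -/

/-! ### Three-term recurrence and partial sums -/

/-- The monic solution `R_k` of `R_{k+1} = z R_k - (a z + b) R_{k-1}` with `R_0 = 1`,
`R_{-1} = 0`. -/
noncomputable abbrev basePoly (a b : ℝ) (k : ℕ) : ℝ[X] := recPoly 1 0 (-a) (-b) k

/-- The partial sum `R_0 + ⋯ + R_n`, which is `(-1) ^ n P_n`. -/
noncomputable def sumPoly (a b : ℝ) (n : ℕ) : ℝ[X] := ∑ k ∈ Finset.range (n + 1), basePoly a b k

theorem sumPoly_zero (a b : ℝ) : sumPoly a b 0 = 1 := by simp [sumPoly, recPoly]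

theorem sumPoly_succ (a b : ℝ) (n : ℕ) :
    sumPoly a b (n + 1) = sumPoly a b n + basePoly a b (n + 1) :=
  Finset.sum_range_succ _ _

theorem basePoly_zero (a b : ℝ) : basePoly a b 0 = 1 := rfl

theorem basePoly_one (a b : ℝ) : basePoly a b 1 = X := by simp [recPoly]

theorem basePoly_succ_succ (a b : ℝ) (n : ℕ) :
    basePoly a b (n + 2) = X * basePoly a b (n + 1) - (C a * X + C b) * basePoly a b n := by
  simp only [basePoly, recPoly, map_one, map_zero, map_neg]
  ring

theorem mk_basePoly_mul_quadratic (a b : ℝ) :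
    PowerSeries.mk (fun n => (-1) ^ n * basePoly a b n) *
      (PowerSeries.C (C a * X + C b) * PowerSeries.X ^ 2 + PowerSeries.C X * PowerSeries.X + 1)
      = 1 := by
  generalize hq : (C a * X + C b : ℝ[X]) = q
  set f := PowerSeries.mk (fun n => (-1) ^ n * basePoly a b n) with hf
  have h : f * (PowerSeries.C q * PowerSeries.X ^ 2 + PowerSeries.C X * PowerSeries.X + 1) =
      PowerSeries.C q * (f * PowerSeries.X * PowerSeries.X) +
      PowerSeries.C X * (f * PowerSeries.X) + f := by ring
  rw [h]
  ext1 n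
  rcases n with _ | _ | n
  · simp [hf, basePoly_zero]
  · simp only [map_add, PowerSeries.coeff_C_mul, PowerSeries.coeff_succ_mul_X]
    simp [hf, basePoly_zero, basePoly_one, PowerSeries.coeff_one]
  · simp only [map_add, PowerSeries.coeff_C_mul, PowerSeries.coeff_succ_mul_X, hf,
      PowerSeries.coeff_mk, basePoly_succ_succ, PowerSeries.coeff_one, hq]
    simp only [Nat.add_eq_zero_iff, one_ne_zero, and_false, if_false]
    ring

theorem mk_sumPoly_mul_X_add_one (a b : ℝ) :
    PowerSeries.mk (fun n => (-1) ^ n * sumPoly a b n) * (PowerSeries.X + 1) =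
      PowerSeries.mk (fun n => (-1) ^ n * basePoly a b n) := by
  rw [mul_add, mul_one]
  ext1 n
  rcases n with _ | n
  · simp [sumPoly_zero, basePoly_zero]
  · simp only [map_add, PowerSeries.coeff_succ_mul_X, PowerSeries.coeff_mk, sumPoly_succ]
    ring

/-- Dividing by `t + 1` turns the coefficients `(-1) ^ n R_n` of `1 / ((a z + b) t² + z t + 1)` into
alternating partial sums. -/
theorem genPoly_eq (a b : ℝ) (n : ℕ) : genPoly a b n = (-1) ^ n * sumPoly a b n := by
  have h : PowerSeries.mk (fun n => (-1) ^ n * sumPoly a b n) * genDenom a b = 1 := by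
    rw [genDenom, ← mul_assoc, mk_sumPoly_mul_X_add_one, mk_basePoly_mul_quadratic]
  have h' := mk_genPoly_mul_genDenom a b
  have : PowerSeries.mk (genPoly a b) = PowerSeries.mk (fun n => (-1) ^ n * sumPoly a b n) :=
    left_inv_eq_right_inv h' (by rw [mul_comm]; exact h)
  simpa using congrArg (PowerSeries.coeff n) this

theorem aeval_genPoly_eq_zero_iff {A : Type*} [CommRing A] [Algebra ℝ A] [NoZeroDivisors A]
    (a b : ℝ) (n : ℕ) (z : A) : aeval z (genPoly a b n) = 0 ↔ aeval z (sumPoly a b n) = 0 := by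
  rcases neg_one_pow_eq_or ℝ[X] n with h | h <;> simp [genPoly_eq, h]

theorem recPoly_eq_comp (a₁ b₁ a₂ b₂ : ℝ) (h : a₁ ≠ 0) (k : ℕ) :
    recPoly a₁ b₁ a₂ b₂ k =
      (basePoly (-(a₂ / a₁)) (a₂ * b₁ / a₁ - b₂) k).comp (C a₁ * X + C b₁) := by
  induction k using Nat.twoStepInduction with
  | zero => simp [recPoly]
  | one => simp [recPoly]
  | more k h0 h1 =>
    have e : (C a₂ * X + C b₂ : ℝ[X]) =
        -(C (-(a₂ / a₁)) * (C a₁ * X + C b₁) + C (a₂ * b₁ / a₁ - b₂)) := by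
      have e1 : (C a₂ : ℝ[X]) = C (a₂ / a₁) * C a₁ := by rw [← C_mul]; congr 1; field_simp
      have e2 : (C (a₂ * b₁ / a₁ - b₂) : ℝ[X]) = C (a₂ / a₁) * C b₁ - C b₂ := by
        rw [← C_mul, ← C_sub]; congr 1; field_simp
      rw [e2, e1, C_neg]; ring
    rw [recPoly, h0, h1, basePoly_succ_succ, e]
    simp only [sub_comp, mul_comp, add_comp, X_comp, C_comp]
    ring

theorem sum_recPoly (a₁ b₁ a₂ b₂ : ℝ) (h : a₁ ≠ 0) (n : ℕ) :
    ∑ k ∈ Finset.range (n + 1), recPoly a₁ b₁ a₂ b₂ k =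
      (-1) ^ n * (genPoly (-(a₂ / a₁)) (a₂ * b₁ / a₁ - b₂) n).comp (C a₁ * X + C b₁) := by
  have hs : ((-1 : ℝ[X]) ^ n) * (-1) ^ n = 1 := by rw [← mul_pow]; simp
  simp only [genPoly_eq, mul_comp, pow_comp, neg_comp, one_comp]
  rw [← mul_assoc, hs, one_mul, sumPoly, Polynomial.sum_comp]
  exact Finset.sum_congr rfl fun k _ => recPoly_eq_comp _ _ _ _ h k

theorem monic_basePoly (a b : ℝ) (n : ℕ) :
    (basePoly a b n).Monic ∧ (basePoly a b n).natDegree = n := by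
  induction n using Nat.twoStepInduction with
  | zero => simp [basePoly_zero]
  | one => simp [basePoly_one]
  | more n h0 h1 =>
    have hd : (X * basePoly a b (n + 1)).natDegree = n + 2 := by
      rw [natDegree_X_mul h1.1.ne_zero, h1.2]
    have hm : (X * basePoly a b (n + 1)).Monic := monic_X.mul h1.1
    have hlt : ((C a * X + C b) * basePoly a b n).degree < (X * basePoly a b (n + 1)).degree := by
      rw [degree_eq_natDegree hm.ne_zero, hd]
      refine lt_of_le_of_lt degree_le_natDegree ?_
      have : ((C a * X + C b) * basePoly a b n).natDegree ≤ 1 + n :=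
        natDegree_mul_le_of_le natDegree_linear_le h0.2.le
      exact_mod_cast (by omega : _ < n + 2)
    rw [basePoly_succ_succ]
    exact ⟨hm.sub_of_left hlt, by
      rw [natDegree_eq_of_degree_eq (degree_sub_eq_left_of_degree_lt hlt), hd]⟩

theorem monic_sumPoly (a b : ℝ) (n : ℕ) :
    (sumPoly a b n).Monic ∧ (sumPoly a b n).natDegree = n := by
  induction n with
  | zero => simp [sumPoly_zero]
  | succ n ih =>
    obtain ⟨hm, hd⟩ := monic_basePoly a b (n + 1)
    have hlt : (sumPoly a b n).degree < (basePoly a b (n + 1)).degree := by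
      rw [degree_eq_natDegree hm.ne_zero, degree_eq_natDegree ih.1.ne_zero, ih.2, hd]
      exact_mod_cast n.lt_succ_self
    rw [sumPoly_succ, add_comm]
    exact ⟨hm.add_of_left hlt, by
      rw [natDegree_eq_of_degree_eq (degree_add_eq_left_of_degree_lt hlt), hd]⟩

section CharacteristicRoots

variable {A : Type*} [CommRing A] [Algebra ℝ A] {a b : ℝ} {z u v : A}

theorem aeval_basePoly_succ (hs : u + v = z)
    (hp : u * v = algebraMap ℝ A a * z + algebraMap ℝ A b) (k : ℕ) :
    aeval z (basePoly a b (k + 1)) = u * aeval z (basePoly a b k) + v ^ (k + 1) := by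
  induction k with
  | zero => simp [basePoly_zero, basePoly_one, hs]
  | succ k ih =>
    rw [basePoly_succ_succ]
    simp only [map_sub, map_mul, map_add, aeval_X, aeval_C]
    rw [← hp, ← hs] at *
    linear_combination v * ih

/-- The Binet formula for `R_k`. -/
theorem sub_mul_aeval_basePoly (hs : u + v = z)
    (hp : u * v = algebraMap ℝ A a * z + algebraMap ℝ A b) (k : ℕ) :
    (u - v) * aeval z (basePoly a b k) = u ^ (k + 1) - v ^ (k + 1) := by
  induction k with
  | zero => simp [basePoly_zero]
  | succ k ih =>
    rw [aeval_basePoly_succ hs hp]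
    linear_combination u * ih

end CharacteristicRoots

/-! ### Trigonometric parametrization of the interval -/

/-- The modulus `ρ` of the characteristic roots `ρ e^{±iθ}`: the positive solution of
`ρ² = 2 a ρ cos θ + b`. -/
noncomputable def rootModulus (a b θ : ℝ) : ℝ :=
  a * Real.cos θ + √((a * Real.cos θ) ^ 2 + b)

/-- The point `z = 2 ρ cos θ` at which the characteristic roots are `ρ e^{±iθ}`. -/
noncomputable def anglePoint (a b θ : ℝ) : ℝ := 2 * rootModulus a b θ * Real.cos θ

theorem continuous_anglePoint (a b : ℝ) : Continuous (anglePoint a b) := by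
  unfold anglePoint rootModulus
  fun_prop

section Parametrization

variable {a b : ℝ}

theorem one_le_rootModulus (hab : 1 + 2 * |a| ≤ b) (θ : ℝ) : 1 ≤ rootModulus a b θ := by
  have hc : |a * Real.cos θ| ≤ |a| := by
    rw [abs_mul]; exact mul_le_of_le_one_right (abs_nonneg a) (Real.abs_cos_le_one θ)
  have h1 : 1 + |a * Real.cos θ| ≤ √((a * Real.cos θ) ^ 2 + b) := by
    apply Real.le_sqrt_of_sq_le
    nlinarith [sq_abs (a * Real.cos θ)]
  have h2 := neg_abs_le (a * Real.cos θ)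
  unfold rootModulus
  linarith

theorem rootModulus_sq (hab : 1 + 2 * |a| ≤ b) (θ : ℝ) :
    rootModulus a b θ ^ 2 = a * anglePoint a b θ + b := by
  have h : √((a * Real.cos θ) ^ 2 + b) ^ 2 = (a * Real.cos θ) ^ 2 + b :=
    Real.sq_sqrt (by nlinarith [abs_nonneg a, sq_nonneg (a * Real.cos θ)])
  unfold anglePoint rootModulus
  linear_combination h

theorem mem_Ioo_iff_sq_lt (hab : 1 + 2 * |a| ≤ b) (x : ℝ) :
    x ∈ Set.Ioo (2 * a - 2 * √(a ^ 2 + b)) (2 * a + 2 * √(a ^ 2 + b)) ↔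
      x ^ 2 < 4 * (a * x + b) := by
  have h0 : 0 ≤ a ^ 2 + b := by nlinarith [abs_nonneg a, sq_nonneg a]
  have h : x ∈ Set.Ioo (2 * a - 2 * √(a ^ 2 + b)) (2 * a + 2 * √(a ^ 2 + b)) ↔
      |(x - 2 * a) / 2| < √(a ^ 2 + b) := by
    rw [abs_lt, Set.mem_Ioo]
    constructor <;> rintro ⟨h1, h2⟩ <;> constructor <;> linarith
  rw [h, Real.lt_sqrt (abs_nonneg _), sq_abs]
  constructor <;> intro h <;> nlinarith

theorem anglePoint_mem_Ioo (hab : 1 + 2 * |a| ≤ b) {θ : ℝ} (hθ : θ ∈ Set.Ioo 0 Real.pi) :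
    anglePoint a b θ ∈ Set.Ioo (2 * a - 2 * √(a ^ 2 + b)) (2 * a + 2 * √(a ^ 2 + b)) := by
  rw [mem_Ioo_iff_sq_lt hab, ← rootModulus_sq hab, anglePoint]
  have h1 := one_le_rootModulus hab θ
  have h2 := Real.sin_pos_of_mem_Ioo hθ
  have h3 : 0 < (rootModulus a b θ * Real.sin θ) ^ 2 := by positivity
  nlinarith [Real.sin_sq_add_cos_sq θ]

theorem cos_eq_of_anglePoint (hab : 1 + 2 * |a| ≤ b) (θ : ℝ) :
    Real.cos θ = anglePoint a b θ / (2 * √(a * anglePoint a b θ + b)) := by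
  have h1 := one_le_rootModulus hab θ
  rw [← rootModulus_sq hab, Real.sqrt_sq (by linarith), anglePoint]
  field_simp

theorem injOn_anglePoint (hab : 1 + 2 * |a| ≤ b) :
    Set.InjOn (anglePoint a b) (Set.Ioo 0 Real.pi) := by
  intro θ hθ φ hφ h
  refine Real.injOn_cos (Set.Ioo_subset_Icc_self hθ) (Set.Ioo_subset_Icc_self hφ) ?_
  rw [cos_eq_of_anglePoint hab θ, h, ← cos_eq_of_anglePoint hab φ]

theorem exists_anglePoint_eq (hab : 1 + 2 * |a| ≤ b) {x : ℝ}
    (hx : x ∈ Set.Ioo (2 * a - 2 * √(a ^ 2 + b)) (2 * a + 2 * √(a ^ 2 + b))) :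
    ∃ θ ∈ Set.Ioo 0 Real.pi, anglePoint a b θ = x := by
  rw [mem_Ioo_iff_sq_lt hab] at hx
  have hpos : 0 < a * x + b := by nlinarith [sq_nonneg x]
  set r := √(a * x + b) with hr
  have hr0 : 0 < r := Real.sqrt_pos.2 hpos
  have hr2 : r ^ 2 = a * x + b := Real.sq_sqrt hpos.le
  have hlt : |x / (2 * r)| < 1 := by
    rw [abs_div, abs_of_pos (by positivity : 0 < 2 * r), div_lt_one (by positivity)]
    exact abs_lt_of_sq_lt_sq (by nlinarith) (by positivity)
  obtain ⟨h1, h2⟩ := abs_lt.1 hlt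
  refine ⟨Real.arccos (x / (2 * r)), ⟨Real.arccos_pos.2 h2, ?_⟩, ?_⟩
  · rw [← Real.arccos_neg_one]
    exact Real.strictAntiOn_arccos ⟨le_rfl, by norm_num⟩ ⟨h1.le, h2.le⟩ h1
  · have hsq : (a * (x / (2 * r))) ^ 2 + b = (r - a * (x / (2 * r))) ^ 2 := by
      field_simp
      linear_combination (-4 * r ^ 2) * hr2
    have hnn : 0 ≤ r - a * (x / (2 * r)) := by
      have : r - a * (x / (2 * r)) = (a * x + 2 * b) / (2 * r) := by
        field_simp
        linear_combination 2 * hr2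
      rw [this]
      have : 0 < b := by linarith [abs_nonneg a]
      apply div_nonneg <;> linarith
    rw [anglePoint, rootModulus, Real.cos_arccos h1.le h2.le, hsq, Real.sqrt_sq hnn]
    field_simp
    ring

/-! ### Sign changes -/

theorem sin_add_sin_eq (c θ : ℝ) :
    Real.sin ((c + 1) * θ) = 2 * Real.cos θ * Real.sin (c * θ) - Real.sin ((c - 1) * θ) := by
  rw [add_mul, sub_mul, one_mul, Real.sin_add, Real.sin_sub]
  ring

/-- On the curve of characteristic roots `ρ e^{±iθ}` the `R_k` are scaled Chebyshev polynomials of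
the second kind. -/
theorem eval_basePoly_mul_sin (hab : 1 + 2 * |a| ≤ b) (θ : ℝ) (k : ℕ) :
    (basePoly a b k).eval (anglePoint a b θ) * Real.sin θ =
      rootModulus a b θ ^ k * Real.sin ((k + 1) * θ) := by
  induction k using Nat.twoStepInduction with
  | zero => simp [basePoly_zero]
  | one =>
    have : ((1 : ℕ) + 1 : ℝ) * θ = 2 * θ := by norm_num
    rw [this, Real.sin_two_mul]
    simp [basePoly_one, anglePoint]
    ring
  | more k h0 h1 =>
    have h := sin_add_sin_eq (k + 2) θ
    rw [show (k : ℝ) + 2 - 1 = k + 1 by ring] at h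
    push_cast at h0 h1 ⊢
    rw [show (k : ℝ) + 1 + 1 = k + 2 by ring] at h1
    rw [basePoly_succ_succ, h]
    simp only [eval_sub, eval_mul, eval_add, eval_X, eval_C]
    rw [← rootModulus_sq hab]
    have hz : anglePoint a b θ = 2 * rootModulus a b θ * Real.cos θ := rfl
    linear_combination anglePoint a b θ * h1 - rootModulus a b θ ^ 2 * h0 +
      (rootModulus a b θ ^ (k + 1) * Real.sin ((k + 2) * θ)) * hz

/-- The closed form of the partial sum on the curve of characteristic roots `λ = ρ e^{iθ}`; the
factor `ρ² - 2 ρ cos θ + 1` is `|λ - 1|²`. -/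
theorem eval_sumPoly_mul_sin (hab : 1 + 2 * |a| ≤ b) (θ : ℝ) (n : ℕ) :
    (sumPoly a b n).eval (anglePoint a b θ) *
        (Real.sin θ * (rootModulus a b θ ^ 2 - 2 * rootModulus a b θ * Real.cos θ + 1)) =
      rootModulus a b θ ^ (n + 2) * Real.sin ((n + 1) * θ) -
        rootModulus a b θ ^ (n + 1) * Real.sin ((n + 2) * θ) + Real.sin θ := by
  induction n with
  | zero =>
    simp only [sumPoly_zero, eval_one, Nat.cast_zero, zero_add, one_mul, Real.sin_two_mul]
    ring
  | succ n ih =>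
    have h := sin_add_sin_eq (n + 2) θ
    have hb := eval_basePoly_mul_sin hab θ (n + 1)
    rw [show (n : ℝ) + 2 - 1 = n + 1 by ring] at h
    push_cast at hb ⊢
    rw [show (n : ℝ) + 1 + 1 = n + 2 by ring] at hb ⊢
    rw [show (n : ℝ) + 1 + 2 = n + 2 + 1 by ring, h, sumPoly_succ, eval_add]
    linear_combination ih +
      (rootModulus a b θ ^ 2 - 2 * rootModulus a b θ * Real.cos θ + 1) * hb

/-- The nodes `2 j π / (2 n + 3)`, at which `sin ((n + 2) θ) = -sin ((n + 1) θ)`. -/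
noncomputable def nodeAngle (n j : ℕ) : ℝ := j * (2 * Real.pi / (2 * n + 3))

theorem nodeAngle_mem_Ioo {n j : ℕ} (h1 : 1 ≤ j) (h2 : j ≤ n + 1) :
    nodeAngle n j ∈ Set.Ioo 0 Real.pi := by
  have h1' : (1 : ℝ) ≤ j := by exact_mod_cast h1
  have h2' : (j : ℝ) ≤ n + 1 := by exact_mod_cast h2
  have hpi := Real.pi_pos
  refine ⟨by unfold nodeAngle; positivity, ?_⟩
  rw [nodeAngle, ← mul_div_assoc, div_lt_iff₀ (by positivity)]
  nlinarith

/-- At the nodes the two oscillating terms of the closed form reinforce each other: with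
`sin ((n + 1) θ) = -(-1) ^ j sin (θ / 2)` they contribute
`-(-1) ^ j ρ ^ (n + 1) (ρ + 1) sin (θ / 2)`, which beats `sin θ = 2 sin (θ / 2) cos (θ / 2)` because
`ρ ≥ 1`. So the signs at the nodes alternate. -/
theorem neg_one_pow_mul_eval_nodeAngle_neg (hab : 1 + 2 * |a| ≤ b) {n j : ℕ} (h1 : 1 ≤ j)
    (h2 : j ≤ n + 1) :
    (-1) ^ j * (sumPoly a b n).eval (anglePoint a b (nodeAngle n j)) < 0 := by
  have hmem := nodeAngle_mem_Ioo h1 h2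
  set θ := nodeAngle n j with hθ
  have hj : (2 * n + 3) * (θ / 2) = j * Real.pi := by
    rw [hθ, nodeAngle]; field_simp
  have e1 : Real.sin ((n + 1) * θ) = -((-1) ^ j * Real.sin (θ / 2)) := by
    rw [show (n + 1) * θ = j * Real.pi - θ / 2 by rw [← hj]; ring, Real.sin_nat_mul_pi_sub]
  have e2 : Real.sin ((n + 2) * θ) = (-1) ^ j * Real.sin (θ / 2) := by
    rw [show (n + 2) * θ = θ / 2 + j * Real.pi by rw [← hj]; ring, Real.sin_add_nat_mul_pi]
  have e3 : Real.sin θ = 2 * Real.sin (θ / 2) * Real.cos (θ / 2) := by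
    rw [← Real.sin_two_mul]; congr 1; ring
  have key := eval_sumPoly_mul_sin hab θ n
  set r := rootModulus a b θ
  have hr : 1 ≤ r := one_le_rootModulus hab θ
  have hs : 0 < Real.sin θ := Real.sin_pos_of_mem_Ioo hmem
  have hs2 : 0 < Real.sin (θ / 2) :=
    Real.sin_pos_of_pos_of_lt_pi (by linarith [hmem.1]) (by linarith [hmem.1, hmem.2])
  have hc2 : |Real.cos (θ / 2)| < 1 := by
    refine abs_lt_of_sq_lt_sq ?_ zero_le_one
    nlinarith [Real.sin_sq_add_cos_sq (θ / 2), pow_pos hs2 2]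
  have hcoef : 0 < Real.sin θ * (r ^ 2 - 2 * r * Real.cos θ + 1) := by
    have : 0 < r ^ 2 - 2 * r * Real.cos θ + 1 := by
      nlinarith [sq_nonneg (r - Real.cos θ), Real.sin_sq_add_cos_sq θ, pow_pos hs 2]
    positivity
  have hpow : 1 ≤ r ^ (n + 1) := one_le_pow₀ hr
  have hsq : ((-1 : ℝ) ^ j) * (-1) ^ j = 1 := by rw [← mul_pow]; simp
  have hcos : (-1) ^ j * Real.cos (θ / 2) < 1 := by
    refine (le_abs_self _).trans_lt ?_
    rwa [abs_mul, abs_pow, abs_neg, abs_one, one_pow, one_mul]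
  have heq : (-1) ^ j * (sumPoly a b n).eval (anglePoint a b θ) *
      (Real.sin θ * (r ^ 2 - 2 * r * Real.cos θ + 1)) =
      Real.sin (θ / 2) * (2 * ((-1) ^ j * Real.cos (θ / 2)) - r ^ (n + 1) * (r + 1)) := by
    rw [e1, e2, e3] at key
    rw [e3]
    linear_combination (-1) ^ j * key -
      (r ^ (n + 2) + r ^ (n + 1)) * Real.sin (θ / 2) * hsq
  have hneg : Real.sin (θ / 2) *
      (2 * ((-1) ^ j * Real.cos (θ / 2)) - r ^ (n + 1) * (r + 1)) < 0 :=
    mul_neg_of_pos_of_neg hs2 (by nlinarith)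
  rw [← heq] at hneg
  exact neg_of_mul_neg_left hneg hcoef.le

theorem exists_zero_between_nodes (hab : 1 + 2 * |a| ≤ b) {n j : ℕ} (h1 : 1 ≤ j) (h2 : j ≤ n) :
    ∃ θ ∈ Set.Ioo (nodeAngle n j) (nodeAngle n (j + 1)),
      (sumPoly a b n).eval (anglePoint a b θ) = 0 := by
  have hlt : nodeAngle n j ≤ nodeAngle n (j + 1) := by
    unfold nodeAngle; have := Real.pi_pos; gcongr; omega
  have hL := neg_one_pow_mul_eval_nodeAngle_neg hab h1 (by omega : j ≤ n + 1)
  have hR := neg_one_pow_mul_eval_nodeAngle_neg hab (by omega : 1 ≤ j + 1)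
    (by omega : j + 1 ≤ n + 1)
  rw [pow_succ] at hR
  have hcont : Continuous fun θ => (-1) ^ j * (sumPoly a b n).eval (anglePoint a b θ) :=
    continuous_const.mul ((sumPoly a b n).continuous.comp (continuous_anglePoint a b))
  obtain ⟨θ, hθ, h0⟩ := intermediate_value_Ioo hlt hcont.continuousOn
    (⟨hL, by linarith⟩ : (0 : ℝ) ∈ Set.Ioo _ _)
  exact ⟨θ, hθ, by simpa using h0⟩

/-! ### Sufficiency and density -/

/-- The sign changes at the `n + 1` nodes account for all `n` zeros. -/
theorem zeros_mem_Ioo (hab : 1 + 2 * |a| ≤ b) (n : ℕ) (w : ℂ)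
    (hw : aeval w (sumPoly a b n) = 0) :
    ∃ x ∈ Set.Ioo (2 * a - 2 * √(a ^ 2 + b)) (2 * a + 2 * √(a ^ 2 + b)), w = (x : ℂ) := by
  choose t ht ht0 using fun i : Fin n =>
    exists_zero_between_nodes hab (Nat.le_add_left 1 (i : ℕ)) (Nat.succ_le_of_lt i.2)
  have hpi : ∀ i, t i ∈ Set.Ioo 0 Real.pi := fun i =>
    ⟨(nodeAngle_mem_Ioo (by omega) (by omega)).1.trans (ht i).1,
      (ht i).2.trans (nodeAngle_mem_Ioo (by omega) (by omega)).2⟩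
  have hmono : StrictMono t := fun i j hij => by
    refine (ht i).2.trans_le (le_trans ?_ (ht j).1.le)
    unfold nodeAngle; have := Real.pi_pos
    have : (i : ℕ) < j := hij
    gcongr; omega
  let f : Fin n → ℂ := fun i => (anglePoint a b (t i) : ℝ)
  have hf : Function.Injective f := fun i j hij =>
    hmono.injective (injOn_anglePoint hab (hpi i) (hpi j) (Complex.ofReal_injective hij))
  by_cases hmem : ∃ i, f i = w
  · obtain ⟨i, rfl⟩ := hmem
    exact ⟨_, anglePoint_mem_Ioo hab (hpi i), rfl⟩
  · -- Otherwise `w` would be a zero in excess of the degree.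
    exfalso
    obtain ⟨hm, hd⟩ := monic_sumPoly a b n
    have hm' := hm.map (algebraMap ℝ ℂ)
    refine hm'.ne_zero (eq_zero_of_natDegree_lt_card_of_eval_eq_zero' _
      (insert w (Finset.univ.image f)) ?_ ?_)
    · intro y hy
      rw [eval_map_algebraMap]
      rcases Finset.mem_insert.1 hy with rfl | hy
      · exact hw
      · obtain ⟨i, -, rfl⟩ := Finset.mem_image.1 hy
        have := ht0 i
        simp only [f]
        rw [← Complex.coe_algebraMap, aeval_algebraMap_apply]
        simp [coe_aeval_eq_eval, this]
    · rw [hm.natDegree_map, hd, Finset.card_insert_of_notMem (by simpa using hmem),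
        Finset.card_image_of_injective _ hf]
      simp

theorem eventually_exists_zero_near (hab : 1 + 2 * |a| ≤ b) {x : ℝ}
    (hx : x ∈ Set.Ioo (2 * a - 2 * √(a ^ 2 + b)) (2 * a + 2 * √(a ^ 2 + b))) {ε : ℝ}
    (hε : 0 < ε) :
    ∀ᶠ n : ℕ in atTop, ∃ y : ℝ, (sumPoly a b n).eval y = 0 ∧ |y - x| < ε := by
  obtain ⟨φ, hφ, rfl⟩ := exists_anglePoint_eq hab hx
  obtain ⟨δ, hδ, hcont⟩ :=
    Metric.continuous_iff.1 (continuous_anglePoint a b) φ ε hε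
  have hlim : Tendsto (fun n : ℕ => 2 * Real.pi / (2 * (n : ℝ) + 3)) atTop (nhds 0) := by
    refine tendsto_const_nhds.div_atTop ?_
    exact tendsto_atTop_add_const_right _ _
      (tendsto_natCast_atTop_atTop.const_mul_atTop (by norm_num))
  filter_upwards [hlim.eventually (gt_mem_nhds hδ), hlim.eventually (gt_mem_nhds hφ.1),
    hlim.eventually (gt_mem_nhds (sub_pos.2 hφ.2))] with n h1 h2 h3
  have hpi := Real.pi_pos
  have hs0 : 0 < 2 * Real.pi / (2 * (n : ℝ) + 3) := by positivity
  have hsn : (n + 3 / 2) * (2 * Real.pi / (2 * (n : ℝ) + 3)) = Real.pi := by field_simp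
  -- `φ` lies between the nodes with indices `j` and `j + 1`.
  set s := 2 * Real.pi / (2 * (n : ℝ) + 3) with hs
  set j := ⌊φ / s⌋₊ with hj
  have hj1 : 1 ≤ j := Nat.le_floor (by rw [Nat.cast_one, one_le_div hs0]; exact h2.le)
  have hjle : j * s ≤ φ := by
    rw [← le_div_iff₀ hs0]; exact Nat.floor_le (div_pos hφ.1 hs0).le
  have hjlt : φ < (j + 1) * s := by rw [← div_lt_iff₀ hs0]; exact Nat.lt_floor_add_one _
  have hjn : j ≤ n := by
    have : ((j : ℝ) + 1) * s < (n + 3 / 2) * s := by rw [hsn]; linarith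
    have : (j : ℝ) < n + 1 := by linarith [lt_of_mul_lt_mul_right this hs0.le]
    exact Nat.lt_succ_iff.1 (by exact_mod_cast this)
  obtain ⟨θ, hθ, h0⟩ := exists_zero_between_nodes hab hj1 hjn
  refine ⟨_, h0, hcont θ ?_⟩
  simp only [nodeAngle, ← hs, Set.mem_Ioo] at hθ
  push_cast at hθ
  rw [Real.dist_eq, abs_lt]
  constructor <;> linarith [hθ.1, hθ.2]

end Parametrization

/-! ### Inequalities for real-rooted polynomials -/

theorem norm_eval_eq_prod_roots {Q : ℂ[X]} (hQ : Q.Monic) (z : ℂ) :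
    ‖Q.eval z‖ = (Q.roots.map fun w => ‖z - w‖).prod := by
  have h := (IsAlgClosed.splits Q).eval_eq_prod_roots_of_monic hQ z
  rw [h]
  simpa [Multiset.map_map] using map_multiset_prod (normHom : ℂ →*₀ ℝ) (Q.roots.map (z - ·))

/-- Moving away vertically from a real point `x` enlarges a polynomial with real zeros
exponentially in its degree. -/
theorem one_add_pow_mul_sq_le {Q : ℂ[X]} (hQ : Q.Monic) {x y K : ℝ} (hK : 0 < K)
    (hreal : ∀ w ∈ Q.roots, w.im = 0) (hbound : ∀ w ∈ Q.roots, ‖(x : ℂ) - w‖ ≤ K) :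
    (1 + y ^ 2 / K ^ 2) ^ Q.natDegree * ‖Q.eval (x : ℂ)‖ ^ 2 ≤
      ‖Q.eval (x + y * Complex.I)‖ ^ 2 := by
  rw [norm_eval_eq_prod_roots hQ, norm_eval_eq_prod_roots hQ,
    (IsAlgClosed.splits Q).natDegree_eq_card_roots, ← Multiset.prod_replicate,
    ← Multiset.map_const', ← Multiset.prod_map_pow, ← Multiset.prod_map_pow,
    ← Multiset.prod_map_mul]
  refine Multiset.prod_map_le_prod_map₀ _ _ (fun w _ => by positivity) fun w hw => ?_
  have hb := hbound w hw
  have him := hreal w hw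
  have e1 : ‖(x : ℂ) - w‖ ^ 2 = (x - w.re) ^ 2 := by
    rw [← Complex.normSq_eq_norm_sq, Complex.normSq_apply]; simp [him]; ring
  have e2 : ‖(x : ℂ) + y * Complex.I - w‖ ^ 2 = (x - w.re) ^ 2 + y ^ 2 := by
    rw [← Complex.normSq_eq_norm_sq, Complex.normSq_apply]; simp [him]; ring
  have e3 : ‖(x : ℂ) - w‖ ^ 2 ≤ K ^ 2 := pow_le_pow_left₀ (norm_nonneg _) hb 2
  rw [e2, ← e1, add_mul, one_mul]
  gcongr
  rw [div_mul_eq_mul_div, div_le_iff₀ (by positivity)]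
  gcongr

/-- Logarithmic midpoint concavity of a real-rooted polynomial on a zero-free interval. -/
theorem norm_eval_mul_norm_eval_neg_le {Q : ℂ[X]} (hQ : Q.Monic) {h : ℝ} (hh : 0 ≤ h)
    (hreal : ∀ w ∈ Q.roots, w.im = 0) (hfree : ∀ w ∈ Q.roots, h < |w.re|) :
    ‖Q.eval (h : ℂ)‖ * ‖Q.eval (-h : ℂ)‖ ≤ ‖Q.eval 0‖ ^ 2 := by
  rw [norm_eval_eq_prod_roots hQ, norm_eval_eq_prod_roots hQ, norm_eval_eq_prod_roots hQ,
    ← Multiset.prod_map_pow, ← Multiset.prod_map_mul]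
  refine Multiset.prod_map_le_prod_map₀ _ _ (fun w _ => by positivity) fun w hw => ?_
  have hf := hfree w hw
  obtain ⟨r, rfl⟩ : ∃ r : ℝ, w = r := ⟨w.re, Complex.ext rfl (hreal w hw)⟩
  rw [Complex.ofReal_re] at hf
  have hsq : h ^ 2 ≤ r ^ 2 := by rw [← sq_abs r]; exact pow_le_pow_left₀ hh hf.le 2
  rw [← norm_mul, ← norm_pow]
  have e1 : ((h : ℂ) - r) * (-h - r) = ((r ^ 2 - h ^ 2 : ℝ) : ℂ) := by push_cast; ring
  have e2 : ((0 : ℂ) - r) ^ 2 = ((r ^ 2 : ℝ) : ℂ) := by push_cast; ring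
  rw [e1, e2, Complex.norm_real, Complex.norm_real, Real.norm_of_nonneg (by linarith),
    Real.norm_of_nonneg (sq_nonneg r)]
  nlinarith [sq_nonneg h]

/-! ### Necessity: `a² + b ≤ 0` -/

theorem exists_nonreal_zero_of_sq_add_nonpos {a b : ℝ} (h : a ^ 2 + b ≤ 0) :
    ∃ z : ℂ, aeval z (sumPoly a b 2) = 0 ∧ z.im ≠ 0 := by
  -- `sumPoly a b 2 = z² + (1 - a) z + (1 - b)` has negative discriminant.
  have hd : 0 < 4 * (1 - b) - (1 - a) ^ 2 := by nlinarith [sq_nonneg (a + 1)]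
  have hs := Real.sq_sqrt hd.le
  have hpos := Real.sqrt_pos.2 hd
  set s := √(4 * (1 - b) - (1 - a) ^ 2)
  refine ⟨⟨(a - 1) / 2, s / 2⟩, ?_, by simpa using hpos.ne'⟩
  simp only [sumPoly_succ, sumPoly_zero, basePoly_succ_succ, zero_add, basePoly_one, basePoly_zero,
    map_add, map_one, map_sub, map_mul, aeval_X, aeval_C, mul_one, Complex.coe_algebraMap]
  apply Complex.ext <;> simp
  · linarith
  · ring

/-! ### Necessity: `b < -1` -/

section ConstantTermBelow

variable {a b : ℝ}

theorem exists_real_characteristic_roots {x : ℝ} (h1 : a * x + b < 0)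
    (h2 : 1 + x + (a * x + b) < 0) :
    ∃ u v : ℝ, 0 < u ∧ v < -1 ∧ u + v = x ∧ u * v = a * x + b := by
  have hd : 0 ≤ x ^ 2 - 4 * (a * x + b) := by nlinarith [sq_nonneg x]
  have hs := Real.sq_sqrt hd
  have hs0 := Real.sqrt_nonneg (x ^ 2 - 4 * (a * x + b))
  set s := √(x ^ 2 - 4 * (a * x + b))
  have hxs : |x| < s := by
    apply abs_lt_of_sq_lt_sq _ hs0
    linarith
  have hu : 0 < (x + s) / 2 := by linarith [(abs_lt.1 hxs).1]
  refine ⟨(x + s) / 2, (x - s) / 2, hu, ?_, by ring, by linarith⟩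
  by_contra! hv
  nlinarith [mul_nonneg (by linarith : 0 ≤ 1 + (x + s) / 2) (by linarith : 0 ≤ 1 + (x - s) / 2)]

/-- Pairing consecutive terms of the even partial sums makes all contributions positive when
`v < -1` and `0 < u`. -/
theorem sub_mul_eval_sumPoly_even {x u v : ℝ} (hs : u + v = x) (hp : u * v = a * x + b) (m : ℕ) :
    (u - v) * (sumPoly a b (2 * m)).eval x =
      ∑ k ∈ Finset.range (m + 1), (u ^ (2 * k) * (u + 1) + v ^ (2 * k) * (-1 - v)) := by
  have hR : ∀ k, (u - v) * (basePoly a b k).eval x = u ^ (k + 1) - v ^ (k + 1) := fun k => by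
    simpa [coe_aeval_eq_eval] using sub_mul_aeval_basePoly (A := ℝ) hs (by simpa using hp) k
  induction m with
  | zero => simp [sumPoly_zero]; ring
  | succ m ih =>
    rw [Finset.sum_range_succ, ← ih, show 2 * (m + 1) = 2 * m + 1 + 1 by ring, sumPoly_succ,
      sumPoly_succ, eval_add, eval_add]
    linear_combination hR (2 * m + 1) + hR (2 * m + 1 + 1)

theorem le_sub_mul_eval_sumPoly_even {x u v : ℝ} (hu : 0 < u) (hv : v < -1) (hs : u + v = x)
    (hp : u * v = a * x + b) (m : ℕ) :
    u ^ (2 * m) * (u + 1) + v ^ (2 * m) * (-1 - v) ≤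
      (u - v) * (sumPoly a b (2 * m)).eval x := by
  rw [sub_mul_eval_sumPoly_even hs hp]
  refine Finset.single_le_sum
    (f := fun k => u ^ (2 * k) * (u + 1) + v ^ (2 * k) * (-1 - v)) (fun k _ => ?_)
    (Finset.self_mem_range_succ m)
  have h1 : 0 < -1 - v := by linarith
  have h2 : 0 ≤ v ^ (2 * k) := (even_two_mul k).pow_nonneg v
  positivity

theorem eval_zero_sumPoly_even_le (hb : b < -1) (m : ℕ) :
    |(sumPoly a b (2 * m)).eval 0| ≤ (-b) ^ (m + 1) / (-b - 1) := by
  have hbase : ∀ k, (basePoly a b (2 * k)).eval 0 = (-b) ^ k ∧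
      (basePoly a b (2 * k + 1)).eval 0 = 0 := by
    intro k
    induction k with
    | zero => simp [basePoly_zero, basePoly_one]
    | succ k ih =>
      have e1 : (basePoly a b (2 * (k + 1))).eval 0 = (-b) ^ (k + 1) := by
        rw [show 2 * (k + 1) = 2 * k + 2 by ring, basePoly_succ_succ]
        simp only [eval_sub, eval_mul, eval_add, eval_X, eval_C, ih.1]
        ring
      refine ⟨e1, ?_⟩
      rw [show 2 * (k + 1) + 1 = (2 * k + 1) + 2 by ring, basePoly_succ_succ]
      simp [ih.2]
  have hsum : (sumPoly a b (2 * m)).eval 0 = ∑ k ∈ Finset.range (m + 1), (-b) ^ k := by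
    induction m with
    | zero => simp [sumPoly_zero]
    | succ m ih =>
      rw [Finset.sum_range_succ, ← ih, show 2 * (m + 1) = 2 * m + 1 + 1 by ring, sumPoly_succ,
        sumPoly_succ, eval_add, eval_add, (hbase m).2, ← (hbase (m + 1)).1]
      ring_nf
  rw [hsum, geom_sum_eq (by linarith), abs_of_nonneg]
  · gcongr
    · linarith
    · linarith
  · exact div_nonneg (sub_nonneg.2 (one_le_pow₀ (by linarith))) (by linarith)

/-- At `z = 0` the characteristic roots `±√(-b)` have equal modulus, and the dominant modulus has
a convex kink there along the real axis. Hence `|Q(h) Q(-h)|` outgrows `Q(0) ^ 2`, where `Q` is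
the partial sum of even index, against logarithmic midpoint concavity. -/
theorem exists_nonreal_zero_of_lt_neg_one (hb : b < -1) :
    ∃ (n : ℕ) (z : ℂ), aeval z (sumPoly a b n) = 0 ∧ z.im ≠ 0 := by
  by_contra! hall
  have ha := abs_nonneg a
  -- On `[-h, h]` the characteristic roots satisfy `v < -1` and `0 < u`.
  obtain ⟨h, hh0, hh1, hh2⟩ : ∃ h : ℝ, 0 < h ∧ h * (1 + |a|) < -b - 1 ∧
      h * (|a| + |a| ^ 2) < -b := by
    refine ⟨(-b - 1) / (2 * (1 + |a|) ^ 2), by apply div_pos <;> [linarith; positivity], ?_, ?_⟩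
    · rw [div_mul_eq_mul_div, div_lt_iff₀ (by positivity)]
      have : 0 < -b - 1 := by linarith
      nlinarith [mul_pos this (by positivity : 0 < 1 + |a|),
        mul_nonneg (mul_nonneg this.le ha) (by positivity : 0 ≤ 1 + |a|)]
    · rw [div_mul_eq_mul_div, div_lt_iff₀ (by positivity)]
      nlinarith [mul_nonneg ha ha]
  have hroots : ∀ x : ℝ, |x| ≤ h → ∃ u v : ℝ, 0 < u ∧ v < -1 ∧ u + v = x ∧ u * v = a * x + b := by
    intro x hx
    have hax : a * x ≤ |a| * h := (le_abs_self _).trans (by rw [abs_mul]; gcongr)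
    have hx' := (le_abs_self x).trans hx
    apply exists_real_characteristic_roots <;> nlinarith
  have hpos : ∀ (m : ℕ) (x : ℝ), |x| ≤ h → 0 < (sumPoly a b (2 * m)).eval x := by
    intro m x hx
    obtain ⟨u, v, hu, hv, hs, hp⟩ := hroots x hx
    have h1 := le_sub_mul_eval_sumPoly_even hu hv hs hp m
    have h2 : 0 ≤ v ^ (2 * m) * (-1 - v) :=
      mul_nonneg ((even_two_mul m).pow_nonneg v) (by linarith)
    have h3 : 0 < u ^ (2 * m) * (u + 1) := by positivity
    exact pos_of_mul_pos_right (by linarith : 0 < (u - v) * _) (by linarith)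
  have hle : ∀ m : ℕ, (sumPoly a b (2 * m)).eval h * (sumPoly a b (2 * m)).eval (-h) ≤
      (sumPoly a b (2 * m)).eval 0 ^ 2 := by
    intro m
    have hm := (monic_sumPoly a b (2 * m)).1.map (algebraMap ℝ ℂ)
    have hroot : ∀ w ∈ ((sumPoly a b (2 * m)).map (algebraMap ℝ ℂ)).roots,
        aeval w (sumPoly a b (2 * m)) = 0 := fun w hw => by
      rw [← eval_map_algebraMap]; exact (mem_roots hm.ne_zero).1 hw
    have hev : ∀ x : ℝ, ((sumPoly a b (2 * m)).map (algebraMap ℝ ℂ)).eval (x : ℂ) =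
        ((sumPoly a b (2 * m)).eval x : ℝ) := fun x => by
      rw [← Complex.coe_algebraMap, eval_map_apply]
    have := norm_eval_mul_norm_eval_neg_le hm hh0.le (fun w hw => hall _ w (hroot w hw))
      fun w hw => by
        by_contra! hcon
        have hwr : w = (w.re : ℂ) := Complex.ext rfl (hall _ w (hroot w hw))
        have h0 := hev w.re
        rw [← hwr, eval_map_algebraMap, hroot w hw] at h0
        exact (hpos m w.re hcon).ne (by exact_mod_cast h0)
    have e0 := hev 0
    have e1 := hev (-h)
    rw [Complex.ofReal_zero] at e0
    rw [Complex.ofReal_neg] at e1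
    rw [hev, e0, e1, Complex.norm_real, Complex.norm_real, Complex.norm_real, Real.norm_eq_abs,
      Real.norm_eq_abs, Real.norm_eq_abs, abs_of_pos (hpos m h (abs_of_pos hh0).le),
      abs_of_pos (hpos m (-h) (by rw [abs_neg, abs_of_pos hh0])), sq_abs] at this
    exact this
  obtain ⟨u, v, hu, hv, hs, hp⟩ := hroots h (abs_of_pos hh0).le
  obtain ⟨u', v', hu', hv', hs', hp'⟩ := hroots (-h) (by rw [abs_neg, abs_of_pos hh0])
  -- The product of the dominant roots at `h` and `-h` exceeds the corresponding product at `0`.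
  have hgrow : -b < u * -v' := by
    have hq : 0 < -v' := by linarith
    have e1 : u ^ 2 = h * u + (-b) - a * h := by rw [← eq_sub_iff_add_eq'] at hs; subst hs; linarith
    have e2 : v' ^ 2 = h * -v' + (-b) + a * h := by
      rw [← eq_sub_iff_add_eq] at hs'; subst hs'; linarith
    set q := -v' with hqdef
    have hq1 : 1 < q := by linarith
    -- The term linear in `h` is positive and dominates the quadratic one for small `h`.
    have e3 : (u * q) ^ 2 = (-b) ^ 2 + h * ((-b) * (u + q) + h * ((u - a) * (q + a))) := by
      have e2' : q ^ 2 = h * q + (-b) + a * h := by rw [hqdef, neg_sq]; exact e2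
      rw [mul_pow, e1, e2']; ring
    have h1 : -(|a| * (u + q) + |a| ^ 2) ≤ (u - a) * (q + a) := by
      have := neg_abs_le a
      have := le_abs_self a
      nlinarith [mul_pos hu hq, sq_abs a]
    have h2 : |a| * (u + q) + |a| ^ 2 ≤ (|a| + |a| ^ 2) * (u + q) := by
      nlinarith [sq_nonneg |a|]
    have h3 : h * ((|a| + |a| ^ 2) * (u + q)) < (-b) * (u + q) := by
      rw [← mul_assoc]; gcongr
    have h4 : 0 < (-b) * (u + q) + h * ((u - a) * (q + a)) := by nlinarith
    refine lt_of_pow_lt_pow_left₀ 2 (by positivity) ?_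
    rw [e3]
    have := mul_pos hh0 h4
    linarith
  set g := u * -v' / -b with hg
  have hg1 : 1 < g := by rw [hg, one_lt_div (by linarith)]; exact hgrow
  have hbound : ∀ m : ℕ, (g ^ 2) ^ m ≤
      (u - v) * (u' - v') / (-1 - v') * ((-b) / (-b - 1)) ^ 2 := by
    intro m
    have h1 := le_sub_mul_eval_sumPoly_even hu hv hs hp m
    have h2 := le_sub_mul_eval_sumPoly_even hu' hv' hs' hp' m
    have hb1 : 0 < -b - 1 := by linarith
    have hv1 : 0 < -1 - v' := by linarith
    have hD : 0 < u - v := by linarith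
    have hD' : 0 < u' - v' := by linarith
    have h1' : u ^ (2 * m) ≤ (u - v) * (sumPoly a b (2 * m)).eval h := by
      have := mul_nonneg ((even_two_mul m).pow_nonneg v) (by linarith : 0 ≤ -1 - v)
      have := pow_pos hu (2 * m)
      nlinarith
    have h2' : v' ^ (2 * m) * (-1 - v') ≤ (u' - v') * (sumPoly a b (2 * m)).eval (-h) := by
      have : 0 < u' ^ (2 * m) * (u' + 1) := by positivity
      linarith
    have h3 : (sumPoly a b (2 * m)).eval 0 ^ 2 ≤ ((-b) ^ (m + 1) / (-b - 1)) ^ 2 := by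
      rw [← sq_abs]
      exact pow_le_pow_left₀ (abs_nonneg _) (eval_zero_sumPoly_even_le hb m) 2
    have h4 : u ^ (2 * m) * (v' ^ (2 * m) * (-1 - v')) ≤
        (u - v) * (u' - v') * ((-b) ^ (m + 1) / (-b - 1)) ^ 2 := by
      refine (mul_le_mul h1' h2' (mul_nonneg ((even_two_mul m).pow_nonneg v') hv1.le)
        ((pow_pos hu _).le.trans h1')).trans ?_
      have := mul_le_mul_of_nonneg_left ((hle m).trans h3) (mul_pos hD hD').le
      linarith
    have hbm : 0 < (-b) ^ (2 * m) := pow_pos (by linarith) _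
    have e1 : (g ^ 2) ^ m = u ^ (2 * m) * v' ^ (2 * m) / (-b) ^ (2 * m) := by
      rw [← pow_mul, hg, div_pow, mul_pow, (even_two_mul m).neg_pow]
    rw [e1, div_le_iff₀ hbm, div_mul_eq_mul_div, div_mul_eq_mul_div, le_div_iff₀ hv1]
    refine (le_of_eq (by ring)).trans (h4.trans (le_of_eq ?_))
    rw [div_pow, div_pow, ← pow_mul]
    ring
  obtain ⟨m, hm⟩ := pow_unbounded_of_one_lt
    ((u - v) * (u' - v') / (-1 - v') * ((-b) / (-b - 1)) ^ 2) (one_lt_pow₀ hg1 two_ne_zero)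
  exact (hbound m).not_gt hm

end ConstantTermBelow

/-! ### Necessity: a double root inside the unit disc -/

section DoubleRoot

/-- The zeros of all the partial sums lie in one disc. -/
theorem exists_zero_bound (a b : ℝ) :
    ∃ M : ℝ, 0 < M ∧ ∀ (n : ℕ) (z : ℂ), aeval z (sumPoly a b n) = 0 → ‖z‖ ≤ M := by
  have ha := abs_nonneg a
  have hb := abs_nonneg b
  set K := 2 * |a| + 3 with hK
  refine ⟨2 * (K + |b|), by positivity, fun n z hz => ?_⟩
  by_contra! hlt
  have hlin : ‖(a : ℂ) * z + b‖ ≤ |a| * ‖z‖ + |b| := by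
    refine (norm_add_le _ _).trans ?_
    simp
  -- Far from the origin the terms grow at least by the factor `K ≥ 3`, so the last one dominates.
  have hgrow : ∀ k, 0 < ‖aeval z (basePoly a b k)‖ ∧
      K * ‖aeval z (basePoly a b k)‖ ≤ ‖aeval z (basePoly a b (k + 1))‖ := by
    intro k
    induction k with
    | zero =>
      simp only [basePoly_zero, basePoly_one, zero_add, map_one, norm_one, aeval_X]
      exact ⟨one_pos, by linarith⟩
    | succ k ih =>
      refine ⟨lt_of_lt_of_le (mul_pos (by positivity) ih.1) ih.2, ?_⟩
      rw [basePoly_succ_succ]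
      simp only [map_sub, map_mul, map_add, aeval_X, aeval_C, Complex.coe_algebraMap]
      have h1 := norm_sub_norm_le (z * aeval z (basePoly a b (k + 1)))
        (((a : ℂ) * z + b) * aeval z (basePoly a b k))
      rw [norm_mul, norm_mul] at h1
      set p := ‖aeval z (basePoly a b k)‖
      set q := ‖aeval z (basePoly a b (k + 1))‖
      have hq : 0 ≤ q := norm_nonneg _
      have h2 : ‖(a : ℂ) * z + b‖ * p ≤ (‖z‖ / 2 + |b|) * q := by
        have h3 : ‖(a : ℂ) * z + b‖ ≤ (‖z‖ / 2 + |b|) * K := by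
          refine hlin.trans ?_
          nlinarith [norm_nonneg z, mul_nonneg hb ha]
        calc ‖(a : ℂ) * z + b‖ * p ≤ (‖z‖ / 2 + |b|) * K * p :=
              mul_le_mul_of_nonneg_right h3 ih.1.le
          _ = (‖z‖ / 2 + |b|) * (K * p) := by ring
          _ ≤ _ := mul_le_mul_of_nonneg_left ih.2 (by positivity)
      nlinarith
  have hsum : ∀ k, ‖aeval z (sumPoly a b k)‖ ≤ 3 / 2 * ‖aeval z (basePoly a b k)‖ := by
    intro k
    induction k with
    | zero => simp [sumPoly_zero, basePoly_zero]; norm_num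
    | succ k ih =>
      rw [sumPoly_succ, map_add]
      refine (norm_add_le _ _).trans ?_
      nlinarith [hgrow k, mul_nonneg ha (hgrow k).1.le]
  rcases n with _ | n
  · simp [sumPoly_zero] at hz
  · rw [sumPoly_succ, map_add, add_eq_zero_iff_eq_neg] at hz
    have h1 := hsum n
    rw [hz, norm_neg] at h1
    nlinarith [hgrow n, mul_nonneg ha (hgrow n).1.le]

theorem exists_norm_sumPoly_le {a b : ℝ} {z u v : ℂ} (hs : u + v = z)
    (hp : u * v = a * z + b) (hu : ‖u‖ < 1) (hv : ‖v‖ < 1) :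
    ∃ B : ℝ, ∀ n, ‖aeval z (sumPoly a b n)‖ ≤ B := by
  set r := max ‖u‖ ‖v‖
  have hr0 : 0 ≤ r := (norm_nonneg u).trans (le_max_left _ _)
  have hr1 : ‖r‖ < 1 := by rw [Real.norm_of_nonneg hr0]; exact max_lt hu hv
  have hbase : ∀ k, ‖aeval z (basePoly a b k)‖ ≤ (k + 1) * r ^ k := by
    intro k
    induction k with
    | zero => simp [basePoly_zero]
    | succ k ih =>
      rw [aeval_basePoly_succ hs hp]
      refine (norm_add_le _ _).trans ?_
      rw [norm_mul, norm_pow]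
      have h1 : ‖u‖ * ‖aeval z (basePoly a b k)‖ ≤ r * ((k + 1) * r ^ k) :=
        mul_le_mul (le_max_left _ _) ih (norm_nonneg _) hr0
      have h2 : ‖v‖ ^ (k + 1) ≤ r ^ (k + 1) :=
        pow_le_pow_left₀ (norm_nonneg _) (le_max_right _ _) _
      refine (add_le_add h1 h2).trans (le_of_eq ?_)
      push_cast
      ring
  have hsummable : Summable fun k : ℕ => ((k : ℝ) + 1) * r ^ k := by
    have h1 := summable_pow_mul_geometric_of_norm_lt_one 1 hr1
    have h2 := summable_geometric_of_norm_lt_one hr1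
    exact (h1.add h2).congr fun k => by ring
  refine ⟨∑' k : ℕ, ((k : ℝ) + 1) * r ^ k, fun n => ?_⟩
  rw [sumPoly, map_sum]
  refine (norm_sum_le _ _).trans ((Finset.sum_le_sum fun k _ => hbase k).trans ?_)
  exact hsummable.sum_le_tsum _ fun k _ => by positivity

theorem tendsto_sumPoly_double_root {a b : ℝ} {z u : ℂ} (hs : u + u = z)
    (hp : u * u = a * z + b) (hu : ‖u‖ < 1) :
    Tendsto (fun n => aeval z (sumPoly a b n)) atTop (nhds (1 / (1 - u) ^ 2)) := by
  have hbase : ∀ k, aeval z (basePoly a b k) = ((k + 1).choose 1 : ℂ) * u ^ k := by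
    intro k
    induction k with
    | zero => simp [basePoly_zero]
    | succ k ih =>
      rw [aeval_basePoly_succ hs hp, ih]
      simp only [Nat.choose_one_right]
      push_cast
      ring
  have h := (hasSum_choose_mul_geometric_of_norm_lt_one 1 hu).tendsto_sum_nat
  refine ((tendsto_add_atTop_iff_nat 1).2 h).congr fun n => ?_
  rw [sumPoly, map_sum]
  exact Finset.sum_congr rfl fun k _ => (hbase k).symm

/-- At an end point `x` of the interval the two characteristic roots coincide. If the double root
is inside the unit disc, the partial sums stay bounded near `x` and converge to a nonzero limit at
`x`, so they cannot grow exponentially from `x` to `x + iy`, as real-rootedness would require. -/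
theorem exists_nonreal_zero_of_double_root {a b c : ℝ} (hc : c ^ 2 = a ^ 2 + b)
    (hlt : |a + c| < 1) :
    ∃ (n : ℕ) (z : ℂ), aeval z (sumPoly a b n) = 0 ∧ z.im ≠ 0 := by
  by_contra! hall
  -- The real point `x` at which `a + c` is a double characteristic root.
  set x := 2 * (a + c) with hx
  have hlim : Tendsto (fun n => aeval (x : ℂ) (sumPoly a b n)) atTop
      (nhds (1 / (1 - ((a + c : ℝ) : ℂ)) ^ 2)) := by
    apply tendsto_sumPoly_double_root
    · rw [hx]; push_cast; ring
    · rw [hx]; norm_cast; linear_combination hc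
    · rwa [Complex.norm_real]
  -- At nearby points `x + iy` both characteristic roots remain in the unit disc.
  obtain ⟨y, hy0, hy⟩ : ∃ y : ℝ, 0 < y ∧
      |a + c| + (y + √(y * (y + 4 * |c|))) / 2 < 1 := by
    have hcont : Continuous fun y : ℝ => |a + c| + (y + √(y * (y + 4 * |c|))) / 2 := by fun_prop
    have h0 : |a + c| + ((0 : ℝ) + √(0 * (0 + 4 * |c|))) / 2 < 1 := by simpa using hlt
    have hev := (hcont.tendsto 0).eventually (gt_mem_nhds h0)
    obtain ⟨y, hy, hy0⟩ := ((hev.filter_mono nhdsWithin_le_nhds).and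
      (self_mem_nhdsWithin : Set.Ioi (0 : ℝ) ∈ nhdsWithin 0 (Set.Ioi 0))).exists
    exact ⟨y, hy0, hy⟩
  set z : ℂ := x + y * Complex.I with hz
  obtain ⟨s, hs⟩ := IsAlgClosed.exists_pow_nat_eq (z ^ 2 - 4 * (a * z + b)) two_pos
  have hsnorm : ‖s‖ ≤ √(y * (y + 4 * |c|)) := by
    apply Real.le_sqrt_of_sq_le
    have hfac : z ^ 2 - 4 * (a * z + b) = (y * Complex.I) * (y * Complex.I + 4 * c) := by
      have hc' : (c : ℂ) ^ 2 = a ^ 2 + b := by exact_mod_cast hc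
      rw [hz, hx]
      push_cast
      linear_combination 4 * hc'
    rw [← norm_pow, hs, hfac, norm_mul]
    have e : ‖(y : ℂ) * Complex.I‖ = y := by simp [abs_of_pos hy0]
    rw [e]
    gcongr
    refine (norm_add_le _ _).trans ?_
    rw [e]
    simp
  have hznorm : ‖z‖ / 2 ≤ |a + c| + y / 2 := by
    have : ‖z‖ ≤ |x| + |y| := (norm_add_le _ _).trans (by simp)
    rw [hx, abs_mul, abs_two, abs_of_pos hy0] at this
    linarith
  have hroot : ∀ t : ℂ, ‖t‖ = ‖s‖ → ‖(z + t) / 2‖ < 1 := by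
    intro t ht
    rw [norm_div, Complex.norm_two]
    have := norm_add_le z t
    rw [ht] at this
    linarith
  obtain ⟨B, hB⟩ := exists_norm_sumPoly_le (a := a) (b := b) (z := z) (u := (z + s) / 2)
    (v := (z + -s) / 2) (by ring) (by linear_combination (-1 / 4 : ℂ) * hs)
    (hroot s rfl) (hroot (-s) (norm_neg s))
  obtain ⟨M, hM0, hM⟩ := exists_zero_bound a b
  have hK : 0 < |x| + M := by positivity
  have hineq : ∀ n : ℕ, (1 + y ^ 2 / (|x| + M) ^ 2) ^ n * ‖aeval (x : ℂ) (sumPoly a b n)‖ ^ 2 ≤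
      B ^ 2 := by
    intro n
    obtain ⟨hmon, hdeg⟩ := monic_sumPoly a b n
    have hm := hmon.map (algebraMap ℝ ℂ)
    have hr : ∀ w ∈ ((sumPoly a b n).map (algebraMap ℝ ℂ)).roots,
        aeval w (sumPoly a b n) = 0 := fun w hw => by
      rw [← eval_map_algebraMap]; exact (mem_roots hm.ne_zero).1 hw
    have := one_add_pow_mul_sq_le (x := x) (y := y) hm hK (fun w hw => hall _ w (hr w hw))
      fun w hw => (norm_sub_le _ _).trans
        (add_le_add (by rw [Complex.norm_real, Real.norm_eq_abs]) (hM n w (hr w hw)))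
    rw [hmon.natDegree_map, hdeg, eval_map_algebraMap, eval_map_algebraMap] at this
    exact this.trans (pow_le_pow_left₀ (norm_nonneg _) (hB n) 2)
  have hne : (1 : ℂ) - ((a + c : ℝ) : ℂ) ≠ 0 := by
    rw [← Complex.ofReal_one, ← Complex.ofReal_sub, Complex.ofReal_ne_zero]
    linarith [(abs_lt.1 hlt).2]
  have hL : 0 < ‖1 / (1 - ((a + c : ℝ) : ℂ)) ^ 2‖ ^ 2 := by
    have := norm_pos_iff.2 (one_div_ne_zero (pow_ne_zero 2 hne))
    positivity
  have hgeom : Tendsto (fun n : ℕ => (1 + y ^ 2 / (|x| + M) ^ 2) ^ n) atTop atTop :=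
    tendsto_pow_atTop_atTop_of_one_lt (by
      have : 0 < y ^ 2 / (|x| + M) ^ 2 := by positivity
      linarith)
  obtain ⟨n, hn⟩ := ((hgeom.atTop_mul_pos hL (hlim.norm.pow 2)).eventually_gt_atTop (B ^ 2)).exists
  exact (hineq n).not_gt hn

theorem exists_nonreal_zero_of_lt {a b : ℝ} (h : b < 1 + 2 * |a|) :
    ∃ (n : ℕ) (z : ℂ), aeval z (sumPoly a b n) = 0 ∧ z.im ≠ 0 := by
  rcases le_or_gt (a ^ 2 + b) 0 with h0 | h0
  · exact ⟨2, exists_nonreal_zero_of_sq_add_nonpos h0⟩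
  rcases lt_or_ge b (-1) with h1 | h1
  · exact exists_nonreal_zero_of_lt_neg_one h1
  have hc := Real.sq_sqrt h0.le
  have hc0 := Real.sqrt_nonneg (a ^ 2 + b)
  set c := √(a ^ 2 + b)
  have ha := abs_nonneg a
  have hsq := sq_abs a
  -- The double roots at the two end points are `a + c` and `a - c`; one of them has modulus
  -- `|c - |a||`, which is less than `1`.
  have hlt1 : c < 1 + |a| := by
    apply lt_of_pow_lt_pow_left₀ 2 (by positivity); nlinarith
  have hlt2 : |a| < 1 + c := by
    by_contra! hle
    have : 0 < c := Real.sqrt_pos.2 h0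
    nlinarith
  rcases le_total 0 a with h2 | h2
  · rw [abs_of_nonneg h2] at hlt1 hlt2
    exact exists_nonreal_zero_of_double_root (c := -c) (by rw [neg_sq]; exact hc)
      (abs_lt.2 ⟨by linarith, by linarith⟩)
  · rw [abs_of_nonpos h2] at hlt1 hlt2
    exact exists_nonreal_zero_of_double_root hc (abs_lt.2 ⟨by linarith, by linarith⟩)

end DoubleRoot

/-! ### Characterization of real-rootedness and location of the zeros -/

theorem theorem1 :
    (∀ a b : ℝ,
      -- All zeros of all `P_n` are real if and only if `1 + 2 |a| ≤ b`.
      ((∀ (n : ℕ) (z : ℂ), aeval z (genPoly a b n) = 0 → z.im = 0) ↔ 1 + 2 * |a| ≤ b) ∧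
      (1 + 2 * |a| ≤ b →
        -- All (complex) zeros lie in the open interval.
        (∀ (n : ℕ) (z : ℂ), aeval z (genPoly a b n) = 0 →
          ∃ x ∈ Set.Ioo (2 * a - 2 * √(a ^ 2 + b)) (2 * a + 2 * √(a ^ 2 + b)), z = (x : ℂ)) ∧
        -- The zeros of `P_n` become dense in the interval as `n → ∞`.
        (∀ x ∈ Set.Ioo (2 * a - 2 * √(a ^ 2 + b)) (2 * a + 2 * √(a ^ 2 + b)), ∀ ε > 0,
          ∀ᶠ n : ℕ in atTop, ∃ y : ℝ, (genPoly a b n).eval y = 0 ∧ |y - x| < ε))) ∧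
    -- Sums of polynomials with a three-term recurrence are the `P_n` up to substitution.
    (∀ a₁ b₁ a₂ b₂ : ℝ, a₁ ≠ 0 → ∀ n : ℕ,
      ∑ k ∈ Finset.range (n + 1), recPoly a₁ b₁ a₂ b₂ k =
        (-1) ^ n * (genPoly (-(a₂ / a₁)) (a₂ * b₁ / a₁ - b₂) n).comp (C a₁ * X + C b₁)) := by
  refine ⟨fun a b => ⟨⟨fun hall => ?_, fun hab n z hz => ?_⟩,
    fun hab => ⟨fun n z hz => zeros_mem_Ioo hab n z ((aeval_genPoly_eq_zero_iff a b n z).1 hz),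
      fun x hx ε hε => ?_⟩⟩, sum_recPoly⟩
  · by_contra! hlt
    obtain ⟨n, z, hz, him⟩ := exists_nonreal_zero_of_lt hlt
    exact him (hall n z ((aeval_genPoly_eq_zero_iff a b n z).2 hz))
  · obtain ⟨x, -, rfl⟩ := zeros_mem_Ioo hab n z ((aeval_genPoly_eq_zero_iff a b n z).1 hz)
    exact Complex.ofReal_im x
  · filter_upwards [eventually_exists_zero_near hab hx hε] with n ⟨y, hy, hlt⟩
    refine ⟨y, ?_, hlt⟩
    rw [← coe_aeval_eq_eval] at hy ⊢
    exact (aeval_genPoly_eq_zero_iff a b n y).2 hy
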